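/- Let $0\le p<n$, let $X$ be a real $n\times p$ matrix of rank $p$, $\beta\in\mathbb R^p$, $\sigma\in\mathbb R$, and let $Y$ be a random vector with $Y-X\beta\sim N(0,\sigma^2I_n)$. Let $\hat\beta=(X^TX)^{-1}X^TY$ and let $R=Y-X\hat\beta$ be the residuals. For a matrix or column vector $A$ with $n$ rows let $A^{(p)}$ and $A_{(p)}$ denote its first $p$ and its last $n-p$ rows. Write $\operatorname{col}(X)^\perp$ for the orthogonal complement in $\mathbb R^n$ of the column space of $X$. The Householder algorithm with standard sign choices, applied to $X=[x_1\ \cdots\ x_p]$, is the following. Let $G_0=I_n$. For $k=0,\dots,p-1$ let $y=G_kx_{k+1}$, let $w$ be $y$ with its first $k$ components replaced by $0$, let $d=\operatorname{sgn}(y_{k+1})$ (either of $\pm1$ if $y_{k+1}=0$), $u=w+d\|w\|e_{k+1}$, $H_{k+1}=I_n-\frac{2}{\|u\|^2}uu^T$ (and $H_{k+1}=I_n$ if $u=0$) and $G_{k+1}=H_{k+1}G_k$. Let $T=(G_pX)^{(p)}$ be the resulting $p\times p$ matrix, which is the upper triangular factor of the QR factorization of $X$. Theorem 3. (a) Whatever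 signs are chosen at zero pivots, $T-X^{(p)}$ is non-singular, and with $v=(T-X^{(p)})^{-1}R^{(p)}$ the vector $W=R_{(p)}+X_{(p)}v$ satisfies $W\sim N(0,\sigma^2I_{n-p})$ and $W^TW=R^TR$. (b) Let $C$ be any non-singular $p\times p$ matrix such that $XC^{-1}$ has orthonormal columns. If $C-X^{(p)}$ is non-singular, then the same two conclusions hold for $W=R_{(p)}+X_{(p)}v$ with $v=(C-X^{(p)})^{-1}R^{(p)}$. More generally, whether or not $C-X^{(p)}$ is non-singular, there is a $p\times p$ matrix $S$ such that (i) $\operatorname{rank}S=\operatorname{rank}(C-X^{(p)})$, (ii) $S=(C-X^{(p)})^{-1}$ if $C-X^{(p)}$ is non-singular, and (iii) for some $n\times(n-p)$ matrix $M$ whose columns are an orthonormal basis of $\operatorname{col}(X)^\perp$, one has $M^Tx=x_{(p)}+X_{(p)}Sx^{(p)}$ for all $x\in\operatorname{col}(X)^\perp$; and for every $S$ with properties (i)–(iii), the vector $W=R_{(p)}+X_{(p)}v$ with $v=SR^{(p)}$ satisfies $W\sim N(0,\sigma^2I_{n-p})$ and $W^TW=R^TR$. -/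

import Mathlib

open Matrix MeasureTheory ProbabilityTheory

noncomputable section

namespace HouseholderRegression

variable {n p : ℕ}

/-- The inclusion of the first `p` of `n` row indices. -/
def firstIdx (h : p ≤ n) : Fin p → Fin n := Fin.castLE h

/-- The inclusion of the last `n - p` of `n` row indices. -/
def lastIdx (h : p ≤ n) : Fin (n - p) → Fin n := fun i => ⟨p + i, by omega⟩

/-- `A^{(p)}`: the first `p` rows of a matrix with `n` rows. -/
def firstRows {κ : Type*} (h : p ≤ n) (A : Matrix (Fin n) κ ℝ) : Matrix (Fin p) κ ℝ :=
  A.submatrix (firstIdx h) id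

/-- `A_{(p)}`: the last `n - p` rows of a matrix with `n` rows. -/
def lastRows {κ : Type*} (h : p ≤ n) (A : Matrix (Fin n) κ ℝ) : Matrix (Fin (n - p)) κ ℝ :=
  A.submatrix (lastIdx h) id

/-- `x^{(p)}`: the first `p` components of a vector in `ℝⁿ`. -/
def firstPart (h : p ≤ n) (x : Fin n → ℝ) : Fin p → ℝ := x ∘ firstIdx h

/-- `x_{(p)}`: the last `n - p` components of a vector in `ℝⁿ`. -/
def lastPart (h : p ≤ n) (x : Fin n → ℝ) : Fin (n - p) → ℝ := x ∘ lastIdx h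

/-! ### The Householder algorithm with the standard sign choice -/

/-- The Householder matrix `I - (2 / ‖v‖²) v vᵀ`, and `I` if `v = 0`. -/
def reflector (v : Fin n → ℝ) : Matrix (Fin n) (Fin n) ℝ :=
  if v = 0 then 1 else 1 - (2 / (v ⬝ᵥ v)) • Matrix.vecMulVec v v

/-- The vector `x` with its first `k` components replaced by `0`. -/
def zeroBelow (k : ℕ) (x : Fin n → ℝ) : Fin n → ℝ := fun i => if (i : ℕ) < k then 0 else x i

/-- The standard sign of the pivot `a`: `sgn a` if `a ≠ 0`; for a zero pivot, where `sgn` does not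
determine a sign, it is the freely chosen `ε`. -/
def pivotSign (ε a : ℝ) : ℝ := if a = 0 then ε else Real.sign a

/-- The vector defining the reflection of step `k` (steps are counted from `0`), where `y` is the
`k`-th column after the previous steps: `(0, …, 0, y_k, …, y_{n-1}) + d ‖(y_k, …, y_{n-1})‖ e_k`,
with `d` the standard sign of `y_k`. -/
def stepVector (ε : ℝ) (k : Fin n) (y : Fin n → ℝ) : Fin n → ℝ :=
  zeroBelow k y + (pivotSign ε (y k) * ‖WithLp.toLp 2 (zeroBelow k y)‖) • Pi.single k (1 : ℝ)

/-- The product `G_k = H_k ⋯ H_2 H_1` of the reflections of the first `k` steps of the Householder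
algorithm applied to `X`, with the standard sign choices; `ε` lists the signs to be taken at
steps with zero pivot. There are `p` steps. -/
def householderProd (h : p ≤ n) (X : Matrix (Fin n) (Fin p) ℝ) (ε : Fin p → ℝ) :
    ℕ → Matrix (Fin n) (Fin n) ℝ
  | 0 => 1
  | k + 1 =>
    if hk : k < p then
      reflector (stepVector (ε ⟨k, hk⟩) (firstIdx h ⟨k, hk⟩)
        (householderProd h X ε k *ᵥ X.col ⟨k, hk⟩)) * householderProd h X ε k
    else householderProd h X ε k

/-- The matrix `T` of the Householder QR factorization of `X`: the first `p` rows of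
`H_p ⋯ H_1 X`. -/
def householderT (h : p ≤ n) (X : Matrix (Fin n) (Fin p) ℝ) (ε : Fin p → ℝ) :
    Matrix (Fin p) (Fin p) ℝ :=
  firstRows h (householderProd h X ε p * X)

/-! ### The orthogonal complement of the column space -/

/-- `col(X)^⊥`: the vectors of `ℝⁿ` orthogonal to every column of `X`. -/
def colPerp (X : Matrix (Fin n) (Fin p) ℝ) : Submodule ℝ (Fin n → ℝ) :=
  LinearMap.ker Xᵀ.mulVecLin

/-- The columns of `M` form an orthonormal basis of `col(X)^⊥`. -/
structure IsOrthonormalBasisColPerp (X : Matrix (Fin n) (Fin p) ℝ)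
    (M : Matrix (Fin n) (Fin (n - p)) ℝ) : Prop where
  orthonormal : Mᵀ * M = 1
  span_eq : Submodule.span ℝ (Set.range M.col) = colPerp X

/-- The property of `S` relative to `X` and `C`: it has the rank of `C - X^{(p)}`, is the inverse
of `C - X^{(p)}` if that matrix is non-singular, and for some `M` whose columns are an orthonormal
basis of `col(X)^⊥`, `Mᵀ x = x_{(p)} + X_{(p)} S x^{(p)}` for all `x ∈ col(X)^⊥`. -/
structure IsCorrectionMatrix (h : p ≤ n) (X : Matrix (Fin n) (Fin p) ℝ)
    (C S : Matrix (Fin p) (Fin p) ℝ) : Prop where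
  rank_eq : S.rank = (C - firstRows h X).rank
  eq_inv : IsUnit (C - firstRows h X).det → S = (C - firstRows h X)⁻¹
  exists_basis : ∃ M : Matrix (Fin n) (Fin (n - p)) ℝ, IsOrthonormalBasisColPerp X M ∧
    ∀ x ∈ colPerp X, Mᵀ *ᵥ x = lastPart h x + lastRows h X *ᵥ (S *ᵥ firstPart h x)

/-! ### Regression -/

/-- The least squares (maximum likelihood) estimator `β̂ = (XᵀX)⁻¹ Xᵀ y`. -/
def betaHat (X : Matrix (Fin n) (Fin p) ℝ) (y : EuclideanSpace ℝ (Fin n)) : Fin p → ℝ :=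
  (Xᵀ * X)⁻¹ *ᵥ (Xᵀ *ᵥ y.ofLp)

/-- The residual vector `R = y - X β̂`. -/
def residual (X : Matrix (Fin n) (Fin p) ℝ) (y : EuclideanSpace ℝ (Fin n)) : Fin n → ℝ :=
  y.ofLp - X *ᵥ betaHat X y

/-- `W = R_{(p)} + X_{(p)} v` with `v = S R^{(p)}`. -/
def adjustedResidual (h : p ≤ n) (X : Matrix (Fin n) (Fin p) ℝ) (S : Matrix (Fin p) (Fin p) ℝ)
    (y : EuclideanSpace ℝ (Fin n)) : EuclideanSpace ℝ (Fin (n - p)) :=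
  WithLp.toLp 2 (lastPart h (residual X y) +
    lastRows h X *ᵥ (S *ᵥ firstPart h (residual X y)))

end HouseholderRegression

end

namespace HouseholderRegression

/-! ### Splitting vectors and matrices into first and last rows. -/

section Blocks

variable {n p : ℕ} (h : p ≤ n)

/-! Write `x = (x₁, x₂)` and `X = (X₁, X₂)` for the block splitting, and `L x = x₂ + X₂ S x₁`.
Orthonormality of the columns of `X C⁻¹` is used only through `Xᵀ X = Cᵀ C`. If `a = S x₁` solves
`(C - X₁) a = x₁`, this identity and `X a ⊥ x` make `L` isometric on `col(X)^⊥`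
(`dotProduct_correctionMap`). That space has dimension `n - p`, so there `L` is `Mᵀ` for an
orthonormal basis `M` (`exists_orthonormalBasis_of_isometry`). Hence `W = Mᵀ R = Mᵀ (Y - X β)`,
which is `N(0, σ² I)`, and `W` and `R` have equal norm.

If `C - X₁` is singular, the equation for `a` is still solvable: `x₁` is orthogonal to the left
kernel of `C - X₁` (`dotProduct_firstPart_eq_zero`), so a reflexive generalized inverse serves as
`S`.

For the Householder factor, `Tᵀ T = Xᵀ X`, and only the non-singularity of `T - X₁` remains. If `T a
= X₁ a`, comparing norms gives `X₂ a = 0`, so `x = X a` is fixed by `H_p ⋯ H_1`. The standard signs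
make the pivot entry of each reflection vector nonzero; this forces `x` to be orthogonal to all
these vectors, and back substitution gives `x = 0`. -/

lemma dotProduct_eq_firstPart_add_lastPart (x y : Fin n → ℝ) :
    x ⬝ᵥ y = firstPart h x ⬝ᵥ firstPart h y + lastPart h x ⬝ᵥ lastPart h y := by
  let e : Fin p ⊕ Fin (n - p) ≃ Fin n := finSumFinEquiv.trans (finCongr (by omega))
  simp only [dotProduct]
  rw [← e.sum_comp, Fintype.sum_sum_type]
  rfl

lemma firstPart_mulVec {m : ℕ} (A : Matrix (Fin n) (Fin m) ℝ) (a : Fin m → ℝ) :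
    firstPart h (A *ᵥ a) = firstRows h A *ᵥ a := rfl

lemma lastPart_mulVec {m : ℕ} (A : Matrix (Fin n) (Fin m) ℝ) (a : Fin m → ℝ) :
    lastPart h (A *ᵥ a) = lastRows h A *ᵥ a := rfl

/-- The matrix of `x ↦ x_{(p)} + X_{(p)} S x^{(p)}`. -/
noncomputable def correctionMap (X : Matrix (Fin n) (Fin p) ℝ) (S : Matrix (Fin p) (Fin p) ℝ) :
    Matrix (Fin (n - p)) (Fin n) ℝ :=
  lastRows h 1 + lastRows h X * (S * firstRows h 1)

lemma correctionMap_mulVec (X : Matrix (Fin n) (Fin p) ℝ) (S : Matrix (Fin p) (Fin p) ℝ)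
    (x : Fin n → ℝ) :
    correctionMap h X S *ᵥ x = lastPart h x + lastRows h X *ᵥ (S *ᵥ firstPart h x) := by
  rw [correctionMap, add_mulVec, ← mulVec_mulVec, ← mulVec_mulVec, ← firstPart_mulVec,
    ← lastPart_mulVec, one_mulVec]

end Blocks

/-! ### Generalized inverses, the residual projection and orthonormal bases. -/

section LinearAlgebra

lemma isUnit_of_rank_eq_card {m : Type*} [Fintype m] [DecidableEq m] {A : Matrix m m ℝ}
    (hA : A.rank = Fintype.card m) : IsUnit A := by
  rw [← mulVec_surjective_iff_isUnit]
  have : LinearMap.range A.mulVecLin = ⊤ := by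
    apply Submodule.eq_top_of_finrank_eq
    rw [Module.finrank_pi]
    exact hA
  exact LinearMap.range_eq_top.1 this

/-- Every square matrix has a reflexive generalized inverse. -/
lemma exists_reflexive_inverse {m : Type*} [Fintype m] [DecidableEq m] (B : Matrix m m ℝ) :
    ∃ S : Matrix m m ℝ, B * S * B = B ∧ S * B * S = S := by
  let f := toLin' B
  obtain ⟨g, hg⟩ := f.rangeRestrict.exists_rightInverse_of_surjective f.range_rangeRestrict
  obtain ⟨q, hq⟩ := (LinearMap.range f).exists_isCompl
  let π := Submodule.projectionOnto _ q hq
  have hπ : ∀ x, π (f x) = f.rangeRestrict x := fun x =>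
    Submodule.projectionOnto_apply_left hq (f.rangeRestrict x)
  have hfg : ∀ v, f (g v) = v := fun v => congrArg Subtype.val (LinearMap.congr_fun hg v)
  -- A section of `f` over its range, extended by zero along the complement `q`.
  let s := g ∘ₗ π
  refine ⟨LinearMap.toMatrix' s, ?_, ?_⟩
  · apply toLin'.injective
    ext1 x
    simp only [toLin'_mul, toLin'_toMatrix']
    ext1
    simp only [LinearMap.comp_apply]
    change f (g (π (f _))) = f _
    rw [hfg, hπ]
    rfl
  · apply toLin'.injective
    ext1 x
    simp only [toLin'_mul, toLin'_toMatrix']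
    ext1
    simp only [LinearMap.comp_apply]
    change g (π (f (g (π _)))) = g (π _)
    rw [hπ]
    congr 1
    exact Subtype.ext (hfg _)

variable {n p : ℕ} {X : Matrix (Fin n) (Fin p) ℝ}

lemma mem_colPerp {x : Fin n → ℝ} : x ∈ colPerp X ↔ Xᵀ *ᵥ x = 0 := Iff.rfl

lemma finrank_colPerp (hX : X.rank = p) : Module.finrank ℝ (colPerp X) = n - p := by
  have := LinearMap.finrank_range_add_finrank_ker Xᵀ.mulVecLin
  rw [Module.finrank_pi, Fintype.card_fin] at this
  change Xᵀ.rank + Module.finrank ℝ (colPerp X) = n at this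
  rw [rank_transpose, hX] at this
  omega

lemma isUnit_det_transpose_mul_self (hX : X.rank = p) : IsUnit (Xᵀ * X).det := by
  rw [← isUnit_iff_isUnit_det]
  apply isUnit_of_rank_eq_card
  rw [rank_transpose_mul_self, hX, Fintype.card_fin]

/-- The orthogonal projection onto `col(X)^⊥`. -/
noncomputable def residualProj (X : Matrix (Fin n) (Fin p) ℝ) : Matrix (Fin n) (Fin n) ℝ :=
  1 - X * ((Xᵀ * X)⁻¹ * Xᵀ)

lemma residual_eq (y : EuclideanSpace ℝ (Fin n)) : residual X y = residualProj X *ᵥ y.ofLp := by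
  simp [residual, betaHat, residualProj, sub_mulVec]

lemma transpose_residualProj : (residualProj X)ᵀ = residualProj X := by
  simp [residualProj, transpose_mul, transpose_nonsing_inv, Matrix.mul_assoc]

lemma transpose_mul_residualProj (hX : X.rank = p) : Xᵀ * residualProj X = 0 := by
  rw [residualProj, Matrix.mul_sub, Matrix.mul_one, ← Matrix.mul_assoc, ← Matrix.mul_assoc,
    mul_nonsing_inv _ (isUnit_det_transpose_mul_self hX), Matrix.one_mul, sub_self]

lemma residualProj_mul (hX : X.rank = p) : residualProj X * X = 0 := by
  have := congrArg transpose (transpose_mul_residualProj hX)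
  rwa [transpose_mul, transpose_residualProj, transpose_transpose, transpose_zero] at this

lemma residualProj_mulVec_mem (hX : X.rank = p) (x : Fin n → ℝ) :
    residualProj X *ᵥ x ∈ colPerp X := by
  rw [mem_colPerp, mulVec_mulVec, transpose_mul_residualProj hX, zero_mulVec]

lemma residualProj_mulVec_of_mem {x : Fin n → ℝ} (hx : x ∈ colPerp X) :
    residualProj X *ᵥ x = x := by
  rw [residualProj, sub_mulVec, one_mulVec, ← mulVec_mulVec, ← mulVec_mulVec, mem_colPerp.1 hx]
  simp

lemma residualProj_mul_self (hX : X.rank = p) : residualProj X * residualProj X = residualProj X := by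
  nth_rw 1 [residualProj]
  rw [sub_mul, Matrix.mul_assoc, Matrix.mul_assoc, transpose_mul_residualProj hX]
  simp

lemma range_residualProj (hX : X.rank = p) :
    LinearMap.range (residualProj X).mulVecLin = colPerp X := by
  ext x
  constructor
  · rintro ⟨y, rfl⟩
    exact residualProj_mulVec_mem hX y
  · exact fun hx => ⟨x, residualProj_mulVec_of_mem hx⟩

/-- A linear map that is isometric on `col(X)^⊥` and has values in a space of the same dimension
agrees there with `Mᵀ` for some `M` whose columns are an orthonormal basis of `col(X)^⊥`. -/
lemma exists_orthonormalBasis_of_isometry (hX : X.rank = p) (L : Matrix (Fin (n - p)) (Fin n) ℝ)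
    (hL : ∀ x ∈ colPerp X, (L *ᵥ x) ⬝ᵥ (L *ᵥ x) = x ⬝ᵥ x) :
    ∃ M : Matrix (Fin n) (Fin (n - p)) ℝ, IsOrthonormalBasisColPerp X M ∧
      ∀ x ∈ colPerp X, Mᵀ *ᵥ x = L *ᵥ x := by
  set Q := residualProj X with hQ
  have hQt : Qᵀ = Q := transpose_residualProj
  have hQQ : Q * Q = Q := residualProj_mul_self hX
  set A := L * Q with hA
  have hAQ : A * Q = A := by rw [hA, Matrix.mul_assoc, hQQ]
  have hpol : ∀ x ∈ colPerp X, ∀ y ∈ colPerp X, (L *ᵥ x) ⬝ᵥ (L *ᵥ y) = x ⬝ᵥ y := by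
    intro x hx y hy
    have h1 := hL _ (add_mem hx hy)
    have h2 := hL x hx
    have h3 := hL y hy
    simp only [mulVec_add, add_dotProduct, dotProduct_add] at h1
    rw [dotProduct_comm (L *ᵥ y), dotProduct_comm y] at h1
    linarith
  have hAA : Aᵀ * A = Q := by
    apply ext_of_mulVec_single
    intro j
    apply dotProduct_eq
    intro w
    rw [← mulVec_mulVec, mulVec_transpose, ← dotProduct_mulVec, hA, ← mulVec_mulVec,
      ← mulVec_mulVec, hpol _ (residualProj_mulVec_mem hX _) _ (residualProj_mulVec_mem hX _),
      ← hQ, dotProduct_mulVec, ← mulVec_transpose, hQt, mulVec_mulVec, hQQ]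
  have hrank : A.rank = n - p := by
    rw [← rank_transpose_mul_self, hAA, ← finrank_colPerp hX, ← range_residualProj hX]
    rfl
  -- `A * Aᵀ` is an idempotent of full rank.
  have hone : A * Aᵀ = 1 := by
    have hu : IsUnit (A * Aᵀ).det := by
      rw [← isUnit_iff_isUnit_det]
      apply isUnit_of_rank_eq_card
      rw [rank_self_mul_transpose, hrank, Fintype.card_fin]
    have h2 : (A * Aᵀ) * (A * Aᵀ) = A * Aᵀ := by
      rw [Matrix.mul_assoc, ← Matrix.mul_assoc Aᵀ, hAA, ← Matrix.mul_assoc, hAQ]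
    calc A * Aᵀ = (A * Aᵀ)⁻¹ * ((A * Aᵀ) * (A * Aᵀ)) := by
          rw [← Matrix.mul_assoc, nonsing_inv_mul _ hu, Matrix.one_mul]
      _ = 1 := by rw [h2, nonsing_inv_mul _ hu]
  refine ⟨Aᵀ, ⟨by rw [transpose_transpose, hone], ?_⟩, fun x hx => ?_⟩
  · rw [← range_mulVecLin]
    ext x
    constructor
    · rintro ⟨y, rfl⟩
      rw [mulVecLin_apply, hA, transpose_mul, hQt, ← mulVec_mulVec]
      exact residualProj_mulVec_mem hX _
    · intro hx
      refine ⟨A *ᵥ x, ?_⟩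
      rw [mulVecLin_apply, mulVec_mulVec, hAA]
      exact residualProj_mulVec_of_mem hx
  · rw [transpose_transpose, hA, ← mulVec_mulVec, residualProj_mulVec_of_mem hx]

variable {M : Matrix (Fin n) (Fin (n - p)) ℝ}

lemma IsOrthonormalBasisColPerp.mulVec_transpose_mulVec (hM : IsOrthonormalBasisColPerp X M)
    {x : Fin n → ℝ} (hx : x ∈ colPerp X) : M *ᵥ (Mᵀ *ᵥ x) = x := by
  rw [← hM.span_eq, ← range_mulVecLin] at hx
  obtain ⟨c, rfl⟩ := hx
  rw [mulVecLin_apply, mulVec_mulVec c Mᵀ, hM.orthonormal, one_mulVec]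

lemma IsOrthonormalBasisColPerp.transpose_mul_residualProj (hM : IsOrthonormalBasisColPerp X M) :
    Mᵀ * residualProj X = Mᵀ := by
  have : residualProj X * M = M := by
    apply ext_of_mulVec_single
    intro j
    rw [← mulVec_mulVec]
    apply residualProj_mulVec_of_mem
    rw [← hM.span_eq, ← range_mulVecLin]
    exact ⟨_, rfl⟩
  have := congrArg transpose this
  rwa [transpose_mul, transpose_residualProj] at this

end LinearAlgebra

/-! ### Isometry of the correction map and existence of `S`. -/

section Correction

variable {n p : ℕ} {X : Matrix (Fin n) (Fin p) ℝ} {C : Matrix (Fin p) (Fin p) ℝ}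

lemma transpose_mul_self_eq (hC : IsUnit C.det) (hXC : (X * C⁻¹)ᵀ * (X * C⁻¹) = 1) :
    Xᵀ * X = Cᵀ * C := by
  have h1 : X * C⁻¹ * C = X := by rw [Matrix.mul_assoc, nonsing_inv_mul _ hC, Matrix.mul_one]
  calc Xᵀ * X = (X * C⁻¹ * C)ᵀ * (X * C⁻¹ * C) := by rw [h1]
    _ = Cᵀ * ((X * C⁻¹)ᵀ * (X * C⁻¹)) * C := by
      rw [transpose_mul _ C]; simp only [Matrix.mul_assoc]
    _ = Cᵀ * C := by rw [hXC, Matrix.mul_one]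

variable (h : p ≤ n)

lemma dotProduct_firstRows_add_lastRows (hXC : Xᵀ * X = Cᵀ * C) (a : Fin p → ℝ) :
    (firstRows h X *ᵥ a) ⬝ᵥ (firstRows h X *ᵥ a) + (lastRows h X *ᵥ a) ⬝ᵥ (lastRows h X *ᵥ a) =
      (C *ᵥ a) ⬝ᵥ (C *ᵥ a) := by
  rw [← firstPart_mulVec, ← lastPart_mulVec, ← dotProduct_eq_firstPart_add_lastPart,
    dotProduct_mulVec, ← mulVec_transpose, mulVec_mulVec, hXC, ← mulVec_mulVec, mulVec_transpose,
    ← dotProduct_mulVec]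

lemma dotProduct_firstRows_of_mem {x : Fin n → ℝ} (hx : x ∈ colPerp X) (a : Fin p → ℝ) :
    (firstRows h X *ᵥ a) ⬝ᵥ firstPart h x + (lastRows h X *ᵥ a) ⬝ᵥ lastPart h x = 0 := by
  rw [← firstPart_mulVec, ← lastPart_mulVec, ← dotProduct_eq_firstPart_add_lastPart,
    dotProduct_comm, dotProduct_mulVec, ← mulVec_transpose, mem_colPerp.1 hx, zero_dotProduct]

/-- `x^{(p)}` is orthogonal to the kernel of `(C - X^{(p)})ᵀ` for `x ∈ col(X)^⊥`. -/
lemma dotProduct_firstPart_eq_zero (hC : IsUnit C.det) (hXC : Xᵀ * X = Cᵀ * C)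
    {x : Fin n → ℝ} (hx : x ∈ colPerp X) {z : Fin p → ℝ} (hz : z ᵥ* (C - firstRows h X) = 0) :
    z ⬝ᵥ firstPart h x = 0 := by
  obtain ⟨a, rfl⟩ : ∃ a, C *ᵥ a = z :=
    ⟨C⁻¹ *ᵥ z, by rw [mulVec_mulVec, mul_nonsing_inv _ hC, one_mulVec]⟩
  have h1 : (C *ᵥ a) ⬝ᵥ ((C - firstRows h X) *ᵥ a) = 0 := by
    rw [dotProduct_mulVec, hz, zero_dotProduct]
  have h2 := dotProduct_firstRows_add_lastRows h hXC a
  have h3 := dotProduct_firstRows_of_mem h hx a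
  set u := C *ᵥ a
  set v := firstRows h X *ᵥ a with hv
  set w := lastRows h X *ᵥ a
  rw [sub_mulVec, dotProduct_sub] at h1
  -- By `h1`, `u ⬝ᵥ v = u ⬝ᵥ u`, so the left side is `v ⬝ᵥ v + w ⬝ᵥ w - u ⬝ᵥ u`, which vanishes by
  -- `h2`. Thus `z = u = v` and `w = 0`, and `h3` is the claim.
  have h4 : (u - v) ⬝ᵥ (u - v) + w ⬝ᵥ w = 0 := by
    simp only [sub_dotProduct, dotProduct_sub]
    rw [dotProduct_comm v u]
    linarith
  have h5 : 0 ≤ (u - v) ⬝ᵥ (u - v) := Finset.sum_nonneg fun i _ => mul_self_nonneg _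
  have h6 : 0 ≤ w ⬝ᵥ w := Finset.sum_nonneg fun i _ => mul_self_nonneg _
  have h7 : w = 0 := dotProduct_self_eq_zero.1 (by linarith)
  have h8 : u - v = 0 := dotProduct_self_eq_zero.1 (by linarith)
  rw [sub_eq_zero.1 h8]
  simpa [h7] using h3

/-- With `a = S x₁`, substituting `C a = x₁ + X₁ a` in `‖X₁ a‖² + ‖X₂ a‖² = ‖C a‖²` gives `‖X₂ a‖² =
‖x₁‖² + 2 x₁ ⬝ X₁ a`. The cross term cancels against `2 x₂ ⬝ X₂ a` because `x ⊥ X a`. -/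
lemma dotProduct_correctionMap (hXC : Xᵀ * X = Cᵀ * C) {S : Matrix (Fin p) (Fin p) ℝ}
    {x : Fin n → ℝ} (hx : x ∈ colPerp X)
    (hS : (C - firstRows h X) *ᵥ (S *ᵥ firstPart h x) = firstPart h x) :
    (correctionMap h X S *ᵥ x) ⬝ᵥ (correctionMap h X S *ᵥ x) = x ⬝ᵥ x := by
  rw [correctionMap_mulVec, dotProduct_eq_firstPart_add_lastPart h x]
  set a := S *ᵥ firstPart h x
  have h2 := dotProduct_firstRows_add_lastRows h hXC a
  have h3 := dotProduct_firstRows_of_mem h hx a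
  rw [sub_mulVec, sub_eq_iff_eq_add] at hS
  rw [hS] at h2
  simp only [add_dotProduct, dotProduct_add] at h2 ⊢
  rw [dotProduct_comm (firstPart h x) (firstRows h X *ᵥ a)] at h2
  rw [dotProduct_comm (lastPart h x) (lastRows h X *ᵥ a)]
  linarith

lemma exists_isCorrectionMatrix (hX : X.rank = p) (hC : IsUnit C.det)
    (hXC : Xᵀ * X = Cᵀ * C) : ∃ S, IsCorrectionMatrix h X C S := by
  set B := C - firstRows h X with hB
  obtain ⟨S, hBSB, hSBS⟩ := exists_reflexive_inverse B
  refine ⟨S, le_antisymm ?_ ?_, fun hu => ?_, ?_⟩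
  · rw [← hSBS]
    exact (rank_mul_le_left _ _).trans (rank_mul_le_right _ _)
  · rw [← hB]
    nth_rw 1 [← hBSB]
    exact (rank_mul_le_left _ _).trans (rank_mul_le_right _ _)
  · calc S = B⁻¹ * (B * S * B) * B⁻¹ := by
          rw [Matrix.mul_assoc B, ← Matrix.mul_assoc B⁻¹, nonsing_inv_mul _ hu, Matrix.one_mul,
            Matrix.mul_assoc, mul_nonsing_inv _ hu, Matrix.mul_one]
      _ = B⁻¹ := by rw [hBSB, nonsing_inv_mul _ hu, Matrix.one_mul]
  · simp_rw [← correctionMap_mulVec]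
    refine exists_orthonormalBasis_of_isometry hX _ fun x hx => ?_
    refine dotProduct_correctionMap h hXC hx ?_
    -- The goal becomes `(1 - B * S) x₁ = 0`; each row of `1 - B * S` lies in the left kernel of
    -- `B`.
    rw [← sub_eq_zero, ← neg_eq_zero, neg_sub, ← hB, mulVec_mulVec]
    nth_rw 1 [← one_mulVec (firstPart h x)]
    rw [← sub_mulVec]
    ext i
    refine dotProduct_firstPart_eq_zero h hC hXC hx ?_
    ext j
    have h0 : (1 - B * S) * B = 0 := by rw [sub_mul, Matrix.one_mul, hBSB, sub_self]
    exact congrFun (congrFun h0 i) j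

end Correction

/-! ### Distribution and norm of the adjusted residuals. -/

section Gaussian

open WithLp

variable {n m : ℕ}

lemma posSemidef_sq_smul_one (σ : ℝ) : (σ ^ 2 • (1 : Matrix (Fin n) (Fin n) ℝ)).PosSemidef :=
  PosSemidef.one.smul (sq_nonneg σ)

/-- A matrix with orthonormal rows maps `N(0, σ² I)` to `N(0, σ² I)`. -/
lemma map_multivariateGaussian_of_orthonormal (M : Matrix (Fin n) (Fin m) ℝ) (hM : Mᵀ * M = 1)
    (σ : ℝ) :
    (multivariateGaussian (0 : EuclideanSpace ℝ (Fin n)) (σ ^ 2 • 1)).map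
        (fun x => toLp 2 (Mᵀ *ᵥ x.ofLp)) =
      multivariateGaussian (0 : EuclideanSpace ℝ (Fin m)) (σ ^ 2 • 1) := by
  have hmeas : Measurable fun x : EuclideanSpace ℝ (Fin n) => toLp 2 (Mᵀ *ᵥ x.ofLp) := by
    apply Continuous.measurable
    fun_prop
  have := Measure.isProbabilityMeasure_map (μ := multivariateGaussian
    (0 : EuclideanSpace ℝ (Fin n)) (σ ^ 2 • 1)) hmeas.aemeasurable
  apply Measure.ext_of_charFun
  ext t
  have h1 : charFun ((multivariateGaussian (0 : EuclideanSpace ℝ (Fin n)) (σ ^ 2 • 1)).map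
      (fun x => toLp 2 (Mᵀ *ᵥ x.ofLp))) t =
      charFun (multivariateGaussian (0 : EuclideanSpace ℝ (Fin n)) (σ ^ 2 • 1))
        (toLp 2 (M *ᵥ t.ofLp)) := by
    rw [charFun_apply, charFun_apply, integral_map hmeas.aemeasurable (by fun_prop)]
    congr 1
    ext x
    congr 3
    simp only [EuclideanSpace.inner_eq_star_dotProduct, star_trivial]
    rw [mulVec_transpose, dotProduct_comm, ← dotProduct_mulVec, dotProduct_comm]
  rw [h1, charFun_multivariateGaussian (posSemidef_sq_smul_one σ),
    charFun_multivariateGaussian (posSemidef_sq_smul_one σ)]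
  have h2 : (M *ᵥ t.ofLp) ⬝ᵥ (M *ᵥ t.ofLp) = t.ofLp ⬝ᵥ t.ofLp := by
    rw [dotProduct_mulVec, ← mulVec_transpose, mulVec_mulVec, hM, one_mulVec]
  simp [smul_mulVec, h2]

variable {p : ℕ} (h : p ≤ n) {X : Matrix (Fin n) (Fin p) ℝ} {C S : Matrix (Fin p) (Fin p) ℝ}

lemma adjustedResidual_eq (hX : X.rank = p)
    {M : Matrix (Fin n) (Fin (n - p)) ℝ}
    (hM : ∀ x ∈ colPerp X, Mᵀ *ᵥ x = lastPart h x + lastRows h X *ᵥ (S *ᵥ firstPart h x))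
    (y : EuclideanSpace ℝ (Fin n)) :
    adjustedResidual h X S y = toLp 2 (Mᵀ *ᵥ residual X y) := by
  rw [adjustedResidual, hM]
  rw [residual_eq]
  exact residualProj_mulVec_mem hX _

theorem IsCorrectionMatrix.hasLaw_and_dotProduct {Ω : Type*} [MeasurableSpace Ω] {P : Measure Ω}
    (hS : IsCorrectionMatrix h X C S) (hX : X.rank = p) (β : Fin p → ℝ) (σ : ℝ)
    (Y : Ω → EuclideanSpace ℝ (Fin n))
    (hY : HasLaw (fun ω => Y ω - toLp 2 (X *ᵥ β))
      (multivariateGaussian (0 : EuclideanSpace ℝ (Fin n))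
        (σ ^ 2 • (1 : Matrix (Fin n) (Fin n) ℝ))) P) :
    HasLaw (fun ω => adjustedResidual h X S (Y ω))
        (multivariateGaussian (0 : EuclideanSpace ℝ (Fin (n - p)))
          (σ ^ 2 • (1 : Matrix (Fin (n - p)) (Fin (n - p)) ℝ))) P ∧
      ∀ ω, (adjustedResidual h X S (Y ω)).ofLp ⬝ᵥ (adjustedResidual h X S (Y ω)).ofLp =
        residual X (Y ω) ⬝ᵥ residual X (Y ω) := by
  obtain ⟨M, hM, hMS⟩ := hS.exists_basis
  have hW := adjustedResidual_eq h hX hMS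
  constructor
  · have hlaw : HasLaw (fun x : EuclideanSpace ℝ (Fin n) => toLp 2 (Mᵀ *ᵥ x.ofLp))
        (multivariateGaussian (0 : EuclideanSpace ℝ (Fin (n - p))) (σ ^ 2 • 1))
        (multivariateGaussian (0 : EuclideanSpace ℝ (Fin n)) (σ ^ 2 • 1)) := by
      refine ⟨Continuous.aemeasurable (by fun_prop), ?_⟩
      exact map_multivariateGaussian_of_orthonormal M hM.orthonormal σ
    convert hlaw.fun_comp hY using 3 with ω
    rw [hW, residual_eq, ofLp_sub, mulVec_sub, mulVec_mulVec, hM.transpose_mul_residualProj]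
    -- The unknown mean drops out, since `Mᵀ` factors through the residual projection.
    have : Mᵀ *ᵥ (X *ᵥ β) = 0 := by
      rw [← hM.transpose_mul_residualProj, mulVec_mulVec, Matrix.mul_assoc, residualProj_mul hX]
      simp
    rw [this, sub_zero]
  · intro ω
    rw [hW]
    have hmem : residual X (Y ω) ∈ colPerp X := by
      rw [residual_eq]
      exact residualProj_mulVec_mem hX _
    change (Mᵀ *ᵥ residual X (Y ω)) ⬝ᵥ (Mᵀ *ᵥ residual X (Y ω)) = _
    rw [dotProduct_mulVec, ← mulVec_transpose, transpose_transpose,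
      hM.mulVec_transpose_mulVec hmem]

end Gaussian

end HouseholderRegression

namespace HouseholderRegression

/-! ### Householder reflections. -/

section Reflector

variable {n : ℕ}

lemma reflector_eq (v : Fin n → ℝ) :
    reflector v = 1 - (2 / (v ⬝ᵥ v)) • Matrix.vecMulVec v v := by
  unfold reflector
  split_ifs with hv
  · simp [hv]
  · rfl

lemma reflector_mulVec (v x : Fin n → ℝ) :
    reflector v *ᵥ x = x - (2 / (v ⬝ᵥ v) * (v ⬝ᵥ x)) • v := by
  rw [reflector_eq, sub_mulVec, one_mulVec, smul_mulVec, vecMulVec_mulVec]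
  ext i
  simp
  ring

lemma reflector_mulVec_apply_of_eq_zero (v x : Fin n → ℝ) {i : Fin n} (hi : v i = 0) :
    (reflector v *ᵥ x) i = x i := by
  simp [reflector_mulVec, hi]

lemma transpose_reflector (v : Fin n → ℝ) : (reflector v)ᵀ = reflector v := by
  simp [reflector_eq, transpose_vecMulVec]

lemma reflector_mul_self (v : Fin n → ℝ) : reflector v * reflector v = 1 := by
  by_cases hv : v = 0
  · simp [reflector, hv]
  have hvv : v ⬝ᵥ v ≠ 0 := fun h0 => hv (dotProduct_self_eq_zero.1 h0)
  apply ext_of_mulVec_single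
  intro j
  rw [← mulVec_mulVec, one_mulVec, reflector_mulVec v (reflector v *ᵥ _), reflector_mulVec,
    dotProduct_sub, dotProduct_smul]
  ext i
  simp only [Pi.sub_apply, Pi.smul_apply, smul_eq_mul]
  field_simp
  ring

end Reflector

/-! ### A single step and its sign choice. -/

section StepVector

variable {n : ℕ} (ε : ℝ) (k : Fin n) (y : Fin n → ℝ)

lemma pivotSign_sq (hε : ε = 1 ∨ ε = -1) (a : ℝ) : pivotSign ε a * pivotSign ε a = 1 := by
  unfold pivotSign
  split_ifs with ha
  · rcases hε with rfl | rfl <;> norm_num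
  · rcases Real.sign_apply_eq_of_ne_zero a ha with h | h <;> rw [h] <;> norm_num

lemma pivotSign_mul_self_nonneg (a : ℝ) : 0 ≤ pivotSign ε a * a := by
  unfold pivotSign
  split_ifs with ha
  · simp [ha]
  · exact Real.sign_mul_nonneg a

lemma stepVector_of_lt {i : Fin n} (hi : i < k) : stepVector ε k y i = 0 := by
  have : (i : ℕ) < k := hi
  simp [stepVector, zeroBelow, this, hi.ne]

lemma stepVector_of_gt {i : Fin n} (hi : k < i) : stepVector ε k y i = y i := by
  have : ¬ (i : ℕ) < k := not_lt.2 (le_of_lt hi)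
  simp [stepVector, zeroBelow, this, hi.ne']

lemma stepVector_self :
    stepVector ε k y k = y k + pivotSign ε (y k) * ‖WithLp.toLp 2 (zeroBelow k y)‖ := by
  simp [stepVector, zeroBelow]

lemma zeroBelow_dotProduct : zeroBelow k y ⬝ᵥ y = zeroBelow k y ⬝ᵥ zeroBelow k y := by
  refine Finset.sum_congr rfl fun i _ => ?_
  unfold zeroBelow
  split_ifs <;> simp

lemma norm_toLp_mul_self (x : Fin n → ℝ) :
    ‖WithLp.toLp 2 x‖ * ‖WithLp.toLp 2 x‖ = x ⬝ᵥ x := by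
  rw [← real_inner_self_eq_norm_mul_norm, EuclideanSpace.inner_eq_star_dotProduct]
  simp

/-- Since `2 u ⬝ y = u ⬝ u` for the step vector `u`, the reflection subtracts exactly one copy of
`u`, which clears the entries of `y` below the pivot. -/
lemma reflector_stepVector_mulVec (hε : ε = 1 ∨ ε = -1) :
    reflector (stepVector ε k y) *ᵥ y = y - stepVector ε k y := by
  by_cases hu : stepVector ε k y = 0
  · simp [hu, reflector]
  have huu : stepVector ε k y ⬝ᵥ stepVector ε k y ≠ 0 :=
    fun h0 => hu (dotProduct_self_eq_zero.1 h0)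
  have key : 2 * (stepVector ε k y ⬝ᵥ y) = stepVector ε k y ⬝ᵥ stepVector ε k y := by
    have hk : zeroBelow k y k = y k := by simp [zeroBelow]
    have hd := pivotSign_sq ε hε (y k)
    have hn := norm_toLp_mul_self (zeroBelow k y)
    simp only [stepVector, add_dotProduct, dotProduct_add, smul_dotProduct, dotProduct_smul,
      single_dotProduct, dotProduct_single, zeroBelow_dotProduct, Pi.add_apply, Pi.smul_apply,
      Pi.single_eq_same, hk,
      smul_eq_mul, one_mul, mul_one]
    linear_combination (-(pivotSign ε (y k) * pivotSign ε (y k))) * hn -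
      (zeroBelow k y ⬝ᵥ zeroBelow k y) * hd
  rw [reflector_mulVec]
  have : 2 / (stepVector ε k y ⬝ᵥ stepVector ε k y) * (stepVector ε k y ⬝ᵥ y) = 1 := by
    rw [div_mul_eq_mul_div, key, div_self huu]
  rw [this, one_smul]

/-- The standard sign choice avoids cancellation: the pivot entry of the reflection vector can
only vanish if the new pivot does. -/
lemma stepVector_self_ne_zero (hε : ε = 1 ∨ ε = -1)
    (hy : (reflector (stepVector ε k y) *ᵥ y) k ≠ 0) : stepVector ε k y k ≠ 0 := by
  intro h0
  apply hy
  rw [reflector_stepVector_mulVec ε k y hε, Pi.sub_apply, h0, sub_zero]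
  rw [stepVector_self] at h0
  have hd := pivotSign_sq ε hε (y k)
  have hp := pivotSign_mul_self_nonneg ε (y k)
  have hn := norm_nonneg (WithLp.toLp 2 (zeroBelow k y))
  set d := pivotSign ε (y k)
  set r := ‖WithLp.toLp 2 (zeroBelow k y)‖
  have hr : r = 0 := by
    -- Both summands are nonnegative, the first by the standard sign choice.
    have : d * y k + r = 0 := by linear_combination d * h0 - r * hd
    linarith
  simpa [hr] using h0

end StepVector

/-! ### The triangular factor and non-singularity of `T - X^{(p)}`. -/

section Algorithm

variable {n p : ℕ} (h : p ≤ n) (X : Matrix (Fin n) (Fin p) ℝ) (ε : Fin p → ℝ)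

/-- The vector of the reflection in step `k` of the Householder algorithm. -/
noncomputable def householderVector (k : Fin p) : Fin n → ℝ :=
  stepVector (ε k) (firstIdx h k) (householderProd h X ε k *ᵥ X.col k)

lemma householderProd_succ (k : Fin p) :
    householderProd h X ε (k + 1) =
      reflector (householderVector h X ε k) * householderProd h X ε k := by
  simp [householderProd, householderVector]

lemma transpose_householderProd_mul_self (m : ℕ) (hm : m ≤ p) :
    (householderProd h X ε m)ᵀ * householderProd h X ε m = 1 := by
  induction m with
  | zero => simp [householderProd]
  | succ m ih =>
    rw [householderProd_succ h X ε ⟨m, hm⟩, transpose_mul, transpose_reflector, Matrix.mul_assoc,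
      ← Matrix.mul_assoc (reflector _), reflector_mul_self, Matrix.one_mul, ih (by omega)]

lemma householderVector_of_lt {k : Fin p} {i : Fin n} (hi : (i : ℕ) < k) :
    householderVector h X ε k i = 0 :=
  stepVector_of_lt _ _ _ hi

/-- Reflection vectors of steps from `k` on vanish in their first `k` entries. -/
lemma householderProd_mulVec_apply_of_lt {k m : ℕ} (hkm : k ≤ m) (hm : m ≤ p) (x : Fin n → ℝ)
    {i : Fin n} (hi : (i : ℕ) < k) :
    (householderProd h X ε m *ᵥ x) i = (householderProd h X ε k *ᵥ x) i := by
  induction m, hkm using Nat.le_induction with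
  | base => rfl
  | succ m hkm ih =>
    rw [householderProd_succ h X ε ⟨m, hm⟩, ← mulVec_mulVec, reflector_mulVec_apply_of_eq_zero,
      ih (by omega)]
    exact householderVector_of_lt h X ε (hi.trans_le hkm)

variable {ε} (hε : ∀ k, ε k = 1 ∨ ε k = -1)
include hε

lemma householderProd_mulVec_col_eq_zero {m : ℕ} (hm : m ≤ p) {j : Fin p} (hj : (j : ℕ) < m)
    {i : Fin n} (hi : (j : ℕ) < i) : (householderProd h X ε m *ᵥ X.col j) i = 0 := by
  induction m generalizing i with
  | zero => omega
  | succ m ih =>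
    rw [householderProd_succ h X ε ⟨m, hm⟩, ← mulVec_mulVec]
    rcases (Nat.lt_succ_iff_lt_or_eq.1 hj) with hjm | rfl
    · rw [reflector_mulVec]
      -- Disjoint supports: the vector lives on indices `≥ m`, the already reduced column on indices
      -- `≤ j < m`.
      have : householderVector h X ε ⟨m, hm⟩ ⬝ᵥ (householderProd h X ε m *ᵥ X.col j) = 0 := by
        refine Finset.sum_eq_zero fun l _ => ?_
        by_cases hl : (l : ℕ) < m
        · rw [householderVector_of_lt h X ε hl, zero_mul]
        · rw [ih (by omega) hjm (by omega), mul_zero]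
      rw [this, mul_zero, zero_smul, sub_zero, ih (by omega) hjm hi]
    · rw [householderVector, reflector_stepVector_mulVec _ _ _ (hε _), Pi.sub_apply,
        stepVector_of_gt _ _ _ hi, sub_self]

lemma householderT_isUpperTriangular : (householderT h X ε).IsUpperTriangular :=
  fun _ j hij => householderProd_mulVec_col_eq_zero h X hε le_rfl j.2 hij

lemma lastRows_householderProd_mul : lastRows h (householderProd h X ε p * X) = 0 := by
  ext i j
  exact householderProd_mulVec_col_eq_zero h X hε le_rfl j.2
    (j.2.trans_le (Nat.le_add_right p i))

lemma transpose_householderT_mul_self : (householderT h X ε)ᵀ * householderT h X ε = Xᵀ * X := by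
  set A := householderProd h X ε p * X with hA
  have h1 : Xᵀ * X = Aᵀ * A := by
    rw [hA, transpose_mul, Matrix.mul_assoc, ← Matrix.mul_assoc _ _ X,
      transpose_householderProd_mul_self h X ε p le_rfl, Matrix.one_mul]
  rw [h1]
  ext i j
  have h2 := dotProduct_eq_firstPart_add_lastPart h (A.col i) (A.col j)
  have h3 : lastPart h (A.col j) = 0 :=
    funext fun l => congrFun (congrFun (lastRows_householderProd_mul h X hε) l) j
  rw [h3, dotProduct_zero, add_zero] at h2
  exact h2.symm

lemma isUnit_det_householderT (hX : X.rank = p) : IsUnit (householderT h X ε).det := by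
  have := isUnit_det_transpose_mul_self hX
  rw [← transpose_householderT_mul_self h X hε, det_mul] at this
  exact isUnit_of_mul_isUnit_right this

lemma householderVector_self_ne_zero (hX : X.rank = p) (k : Fin p) :
    householderVector h X ε k (firstIdx h k) ≠ 0 := by
  have hT := (isUnit_det_householderT h X hε hX).ne_zero
  rw [det_of_isUpperTriangular (householderT_isUpperTriangular h X hε)] at hT
  -- This is a diagonal entry of the triangular non-singular `T`; it is already final after step
  -- `k`.
  have hk : (householderProd h X ε p *ᵥ X.col k) (firstIdx h k) ≠ 0 :=
    Finset.prod_ne_zero_iff.1 hT k (Finset.mem_univ k)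
  rw [householderProd_mulVec_apply_of_lt h X ε (k := k + 1) k.2 le_rfl _ (Nat.lt_succ_self k),
    householderProd_succ, ← mulVec_mulVec] at hk
  exact stepVector_self_ne_zero _ _ _ (hε k) hk

/-- A fixed point of the product of the Householder reflections is orthogonal to all reflection
vectors. -/
lemma householderVector_dotProduct_eq_zero (hX : X.rank = p) {x : Fin n → ℝ}
    (hx : householderProd h X ε p *ᵥ x = x) (k : Fin p) :
    householderVector h X ε k ⬝ᵥ x = 0 := by
  have step : ∀ k : Fin p, householderProd h X ε k *ᵥ x = x →
      householderVector h X ε k ⬝ᵥ x = 0 := by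
    intro k hk
    -- Step `k` is the last that can change entry `k`. As `x` is unchanged both before step `k` and
    -- at the end, the multiple of the reflection vector subtracted in this step has zero pivot
    -- entry, hence zero coefficient.
    have h1 := householderProd_mulVec_apply_of_lt h X ε (k := k + 1) k.2 le_rfl x
      (i := firstIdx h k) (Nat.lt_succ_self k)
    have hne := householderVector_self_ne_zero h X hε hX k
    rw [hx, householderProd_succ, ← mulVec_mulVec, hk, reflector_mulVec] at h1
    simp only [Pi.sub_apply, Pi.smul_apply, smul_eq_mul] at h1
    have hvv : householderVector h X ε k ⬝ᵥ householderVector h X ε k ≠ 0 := by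
      intro h0
      rw [dotProduct_self_eq_zero.1 h0] at hne
      exact hne rfl
    have h2 : 2 / (householderVector h X ε k ⬝ᵥ householderVector h X ε k) *
        (householderVector h X ε k ⬝ᵥ x) * householderVector h X ε k (firstIdx h k) = 0 := by
      linarith
    simpa [hne, hvv] using h2
  have fixed : ∀ m ≤ p, householderProd h X ε m *ᵥ x = x := by
    intro m
    induction m with
    | zero => intro _; simp [householderProd]
    | succ m ih =>
      intro hm
      have hxm := ih (by omega)
      rw [householderProd_succ h X ε ⟨m, hm⟩, ← mulVec_mulVec, hxm, reflector_mulVec,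
        step ⟨m, hm⟩ hxm]
      simp
  exact step k (fixed k k.2.le)

lemma eq_zero_of_householderProd_mulVec_eq (hX : X.rank = p) {x : Fin n → ℝ}
    (hx : householderProd h X ε p *ᵥ x = x) (hlast : lastPart h x = 0) : x = 0 := by
  -- Back substitution: orthogonality to the vector of step `i`, which starts at entry `i` with a
  -- nonzero value, kills `x i` once all later entries vanish.
  have key : ∀ j ≤ p, ∀ i : Fin n, p - j ≤ i → x i = 0 := by
    intro j
    induction j with
    | zero =>
      intro _ i hi
      have hi' : p ≤ i := by simpa using hi
      have := congrFun hlast ⟨i - p, by omega⟩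
      simpa [lastPart, lastIdx, Nat.add_sub_cancel' hi'] using this
    | succ j ih =>
      intro hj i hi
      by_cases hij : p - j ≤ i
      · exact ih (by omega) i hij
      have hip : (i : ℕ) < p := by omega
      have h1 := householderVector_dotProduct_eq_zero h X hε hX hx ⟨i, hip⟩
      have hne := householderVector_self_ne_zero h X hε hX ⟨i, hip⟩
      change householderVector h X ε ⟨i, hip⟩ i ≠ 0 at hne
      rw [dotProduct, Finset.sum_eq_single i] at h1
      · exact (mul_eq_zero.1 h1).resolve_left hne
      · intro l _ hl
        by_cases hli : (l : ℕ) < i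
        · rw [householderVector_of_lt h X ε hli, zero_mul]
        · have : (l : ℕ) ≠ i := fun h0 => hl (Fin.ext h0)
          rw [ih (by omega) l (by omega), mul_zero]
      · simp
  ext i
  exact key p le_rfl i (by omega)

lemma isUnit_det_householderT_sub (hX : X.rank = p) :
    IsUnit (householderT h X ε - firstRows h X).det := by
  rw [isUnit_iff_ne_zero]
  intro hdet
  obtain ⟨a, ha, haz⟩ := exists_mulVec_eq_zero_iff.2 hdet
  rw [sub_mulVec, sub_eq_zero] at haz
  have h1 := dotProduct_firstRows_add_lastRows h
    (transpose_householderT_mul_self h X hε).symm a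
  rw [haz, add_eq_left] at h1
  have hlast : lastPart h (X *ᵥ a) = 0 := dotProduct_self_eq_zero.1 h1
  have hfix : householderProd h X ε p *ᵥ (X *ᵥ a) = X *ᵥ a := by
    ext i
    by_cases hi : (i : ℕ) < p
    · rw [mulVec_mulVec]
      exact congrFun haz ⟨i, hi⟩
    · have hi' : i = lastIdx h ⟨i - p, by omega⟩ := Fin.ext (by simp [lastIdx]; omega)
      rw [hi', mulVec_mulVec]
      change (lastRows h (householderProd h X ε p * X) *ᵥ a) _ = lastPart h (X *ᵥ a) _
      rw [hlast, lastRows_householderProd_mul h X hε, zero_mulVec]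
  have h0 := eq_zero_of_householderProd_mulVec_eq h X hε hX hfix hlast
  apply ha
  rw [← firstPart_mulVec, h0] at haz
  have hu := isUnit_det_householderT h X hε hX
  calc a = (householderT h X ε)⁻¹ *ᵥ (householderT h X ε *ᵥ a) := by
        rw [mulVec_mulVec, nonsing_inv_mul _ hu, one_mulVec]
    _ = 0 := by rw [haz]; exact mulVec_zero _

end Algorithm

end HouseholderRegression

/-! ### The main theorem. -/

theorem theorem3 {Ω : Type*} [MeasurableSpace Ω] (P : Measure Ω) [IsProbabilityMeasure P]
    {n p : ℕ} (hpn : p < n) (X : Matrix (Fin n) (Fin p) ℝ) (hX : X.rank = p)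
    (β : Fin p → ℝ) (σ : ℝ) (Y : Ω → EuclideanSpace ℝ (Fin n))
    (hY : HasLaw (fun ω => Y ω - WithLp.toLp 2 (X *ᵥ β))
      (multivariateGaussian (0 : EuclideanSpace ℝ (Fin n))
        (σ ^ 2 • (1 : Matrix (Fin n) (Fin n) ℝ))) P) :
    -- the version with the Householder matrix `T`, standard sign choices
    (∀ ε : Fin p → ℝ, (∀ k, ε k = 1 ∨ ε k = -1) →
      ∀ T, T = HouseholderRegression.householderT hpn.le X ε →
      IsUnit (T - HouseholderRegression.firstRows hpn.le X).det ∧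
      ∀ W, W = (fun ω => HouseholderRegression.adjustedResidual hpn.le X
          (T - HouseholderRegression.firstRows hpn.le X)⁻¹ (Y ω)) →
        HasLaw W (multivariateGaussian (0 : EuclideanSpace ℝ (Fin (n - p)))
          (σ ^ 2 • (1 : Matrix (Fin (n - p)) (Fin (n - p)) ℝ))) P ∧
        ∀ ω, (W ω).ofLp ⬝ᵥ (W ω).ofLp =
          HouseholderRegression.residual X (Y ω) ⬝ᵥ HouseholderRegression.residual X (Y ω)) ∧
    -- the versions with a matrix `C` such that `X C⁻¹` has orthonormal columns
    (∀ C : Matrix (Fin p) (Fin p) ℝ, IsUnit C.det → (X * C⁻¹)ᵀ * (X * C⁻¹) = 1 →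
      (IsUnit (C - HouseholderRegression.firstRows hpn.le X).det →
        ∀ W, W = (fun ω => HouseholderRegression.adjustedResidual hpn.le X
            (C - HouseholderRegression.firstRows hpn.le X)⁻¹ (Y ω)) →
          HasLaw W (multivariateGaussian (0 : EuclideanSpace ℝ (Fin (n - p)))
            (σ ^ 2 • (1 : Matrix (Fin (n - p)) (Fin (n - p)) ℝ))) P ∧
          ∀ ω, (W ω).ofLp ⬝ᵥ (W ω).ofLp =
            HouseholderRegression.residual X (Y ω) ⬝ᵥ HouseholderRegression.residual X (Y ω)) ∧
      (∃ S, HouseholderRegression.IsCorrectionMatrix hpn.le X C S) ∧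
      (∀ S, HouseholderRegression.IsCorrectionMatrix hpn.le X C S →
        ∀ W, W = (fun ω => HouseholderRegression.adjustedResidual hpn.le X S (Y ω)) →
          HasLaw W (multivariateGaussian (0 : EuclideanSpace ℝ (Fin (n - p)))
            (σ ^ 2 • (1 : Matrix (Fin (n - p)) (Fin (n - p)) ℝ))) P ∧
          ∀ ω, (W ω).ofLp ⬝ᵥ (W ω).ofLp =
            HouseholderRegression.residual X (Y ω) ⬝ᵥ HouseholderRegression.residual X (Y ω))) := by
  -- Some correction matrix exists, and in the non-singular case property (ii) identifies it with
  -- the inverse.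
  have inverse_case : ∀ C : Matrix (Fin p) (Fin p) ℝ, IsUnit C.det → Xᵀ * X = Cᵀ * C →
      IsUnit (C - HouseholderRegression.firstRows hpn.le X).det →
      HouseholderRegression.IsCorrectionMatrix hpn.le X C
        (C - HouseholderRegression.firstRows hpn.le X)⁻¹ := by
    intro C hC hXC hu
    obtain ⟨S, hS⟩ := HouseholderRegression.exists_isCorrectionMatrix hpn.le hX hC hXC
    rwa [← hS.eq_inv hu]
  refine ⟨?_, ?_⟩
  · rintro ε hε T rfl
    have hu := HouseholderRegression.isUnit_det_householderT_sub hpn.le X hε hX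
    refine ⟨hu, ?_⟩
    rintro W rfl
    exact (inverse_case _ (HouseholderRegression.isUnit_det_householderT hpn.le X hε hX)
      (HouseholderRegression.transpose_householderT_mul_self hpn.le X hε).symm
      hu).hasLaw_and_dotProduct hpn.le hX β σ Y hY
  · intro C hC hXC
    have hXC' := HouseholderRegression.transpose_mul_self_eq hC hXC
    refine ⟨?_, HouseholderRegression.exists_isCorrectionMatrix hpn.le hX hC hXC', ?_⟩
    · rintro hu W rfl
      exact (inverse_case C hC hXC' hu).hasLaw_and_dotProduct hpn.le hX β σ Y hY
    · rintro S hS W rfl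
      exact hS.hasLaw_and_dotProduct hpn.le hX β σ Y hY
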